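/- Let $n$ be a dimension and $0<p<\infty$. For $g:\mathbb R^{n+1}_+=(0,\infty)\times\mathbb R^n\to\mathbb C$ locally square integrable (square integrable on every compact subset of the open half space), put $$Vg(x)=\Big(\int_0^\infty|g(t,x)|^2\,\frac{dt}{t}\Big)^{1/2},\qquad A^{(1)}g(x)=\Big(\int_{\mathbb R^{n+1}_+}\frac{1_{B(x,t)}(y)}{t^n}\,|g(t,y)|^2\,\frac{dy\,dt}{t}\Big)^{1/2},\qquad \|g\|_{T^{p,2}_1}=\|A^{(1)}g\|_{p},$$ where $B(x,t)$ is the open Euclidean ball in $\mathbb R^n$ with centre $x$ and radius $t$, and $\|\cdot\|_p$ is the $L^p(\mathbb R^n)$ (quasi-)norm; all these quantities take values in $[0,\infty]$. Then there is a constant $0<C<\infty$, depending only on $n$ and $p$, such that for every locally square integrable $g$, $$\|Vg\|_p\le C\,\|g\|_{T^{p,2}_1}\quad\text{if } p\le 2,\qquad \|Vg\|_p\ge C\,\|g\|_{T^{p,2}_1}\quad\text{if } p\ge 2.$$ -/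

import Mathlib

open MeasureTheory Set Metric
open scoped ENNReal

noncomputable section

/-- The open upper half space `ℝ^{n+1}_+`, the set of `(t, y)` with `t > 0` and `y ∈ ℝⁿ`. -/
def upperHalfSpace (n : ℕ) : Set (ℝ × EuclideanSpace ℝ (Fin n)) :=
  {z | 0 < z.1}

/-- Local square integrability on the open upper half space: `g` is square integrable
(in particular a.e. strongly measurable) on every compact subset of it. -/
def LocallySquareIntegrable {n : ℕ} (g : ℝ × EuclideanSpace ℝ (Fin n) → ℂ) : Prop :=
  ∀ K : Set (ℝ × EuclideanSpace ℝ (Fin n)), IsCompact K → K ⊆ upperHalfSpace n →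
    MemLp g 2 (volume.restrict K)

/-- The conical square function
`A^{(α)} g(x) = (∫_{ℝ^{n+1}_+} 1_{B(x, α t)}(y) t^{-n} |g(t, y)|² dy dt / t)^{1/2}`,
with values in `[0, ∞]`. -/
def conicalSquare {n : ℕ} (α : ℝ) (g : ℝ × EuclideanSpace ℝ (Fin n) → ℂ)
    (x : EuclideanSpace ℝ (Fin n)) : ℝ≥0∞ :=
  (∫⁻ z in upperHalfSpace n,
    (ball x (α * z.1)).indicator (fun _ => (1 : ℝ≥0∞)) z.2 / ENNReal.ofReal z.1 ^ n
      * ‖g z‖ₑ ^ 2 / ENNReal.ofReal z.1) ^ (1 / 2 : ℝ)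

/-- The tent space (quasi-)norm `‖g‖_{T^{p,2}_α} = ‖A^{(α)} g‖_p`, for a finite exponent `p > 0`,
with values in `[0, ∞]`. -/
def tentNorm {n : ℕ} (p α : ℝ) (g : ℝ × EuclideanSpace ℝ (Fin n) → ℂ) : ℝ≥0∞ :=
  eLpNorm (conicalSquare α g) (ENNReal.ofReal p) volume

/-- The vertical square function `V g(x) = (∫_0^∞ |g(t, x)|² dt / t)^{1/2}`,
with values in `[0, ∞]`. -/
def verticalSquare {n : ℕ} (g : ℝ × EuclideanSpace ℝ (Fin n) → ℂ)
    (x : EuclideanSpace ℝ (Fin n)) : ℝ≥0∞ :=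
  (∫⁻ t in Ioi (0 : ℝ), ‖g (t, x)‖ₑ ^ 2 / ENNReal.ofReal t) ^ (1 / 2 : ℝ)

end

/-! Put `q = p / 2`, `H = |g|²`, `F = (Vg)²` and `G = (A⁽¹⁾g)²`; the claim compares `∫ F ^ q` with
`∫ G ^ q`. Everything rests on one Tonelli identity (`lintegral_mul_coneIntegral`): since `y ∈
B(x,t)` iff `x ∈ B(y,t)`, testing `G` against a weight `φ` amounts to integrating `H(t,y) dt/t dy`
against `t⁻ⁿ ∫_{B(y,t)} φ`. Let `ω` be the volume of the unit ball.

For `p = 2` take `φ = 1`: then `∫ G = ω ∫ F`.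

For `p > 2` argue by duality: the averages of `φ` are at most its maximal function, so `∫ φ G ≲ ∫ F
· Mφ`. Taking `φ` to be essentially `G ^ (q - 1)`, Hölder and the maximal theorem in the dual
exponent give the bound.

For `p < 2` argue level by level. Let `O = {G > s}` and take `φ = 1` off `O`. Where `M 1_O` is
small, `O` fills at most half of every centred ball, so the integral of `F` there is `≲ ∫_{Oᶜ} G`;
the remaining points have measure `≲ |O|` by the weak type bound. Chebyshev and integration against
`s ^ (q - 1) ds` finish, the integral converging because `q < 1`. -/

/-! ### Power integrals and layer cake formulas in `[0, ∞]`. -/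

theorem setLIntegral_Ioi_rpow_eq_top (r : ℝ) :
    ∫⁻ s in Ioi (0 : ℝ), ENNReal.ofReal (s ^ r) = ∞ := by
  by_contra h
  refine not_integrableOn_Ioi_rpow r ⟨?_, ?_⟩
  · exact (by fun_prop : Measurable fun s : ℝ => s ^ r).aestronglyMeasurable
  · rw [hasFiniteIntegral_iff_ofReal]
    · exact lt_top_iff_ne_top.2 h
    · filter_upwards [ae_restrict_mem measurableSet_Ioi] with s hs
      exact Real.rpow_nonneg (le_of_lt hs) _

theorem setLIntegral_Ioi_indicator_lt_rpow {p : ℝ} (hp : 0 < p) (x : ℝ≥0∞) :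
    ∫⁻ s in Ioi (0 : ℝ), {s : ℝ | ENNReal.ofReal s < x}.indicator
      (fun s => ENNReal.ofReal (s ^ (p - 1))) s = ENNReal.ofReal (1 / p) * x ^ p := by
  have hp' : ENNReal.ofReal (1 / p) ≠ 0 := by simpa using hp
  rcases eq_or_ne x 0 with rfl | h0
  · simp [hp]
  induction x with
  | top =>
    simp only [ENNReal.ofReal_lt_top, Set.ofPred_true, indicator_univ]
    rw [setLIntegral_Ioi_rpow_eq_top, ENNReal.top_rpow_of_pos hp, ENNReal.mul_top hp']
  | coe x =>
    have hx : 0 < (x : ℝ) := by exact_mod_cast pos_iff_ne_zero.2 h0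
    have hmeas : MeasurableSet {s : ℝ | ENNReal.ofReal s < (x : ℝ≥0∞)} :=
      measurableSet_lt (by fun_prop) (by fun_prop)
    have hset : {s : ℝ | ENNReal.ofReal s < (x : ℝ≥0∞)} ∩ Ioi 0 = Ioo 0 (x : ℝ) := by
      ext s
      simp only [mem_inter_iff, Set.mem_ofPred_eq, mem_Ioi, mem_Ioo]
      constructor
      · rintro ⟨h, hs⟩
        exact ⟨hs, (ENNReal.ofReal_lt_coe_iff hs.le).1 h⟩
      · rintro ⟨hs, h⟩
        exact ⟨(ENNReal.ofReal_lt_coe_iff hs.le).2 h, hs⟩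
    have hint : IntegrableOn (fun s : ℝ => s ^ (p - 1)) (Ioc 0 (x : ℝ)) :=
      (intervalIntegral.intervalIntegrable_rpow' (by linarith : -1 < p - 1)).1
    rw [lintegral_indicator hmeas, Measure.restrict_restrict hmeas,
      hset, setLIntegral_congr Ioo_ae_eq_Ioc, ← ofReal_integral_eq_lintegral_ofReal hint,
      ← intervalIntegral.integral_of_le hx.le, integral_rpow (Or.inl (by linarith)),
      ← ENNReal.ofReal_coe_nnreal, ENNReal.ofReal_rpow_of_pos hx, ← ENNReal.ofReal_mul (by positivity)]
    · congr 1
      rw [sub_add_cancel, Real.zero_rpow hp.ne']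
      ring
    · filter_upwards [ae_restrict_mem measurableSet_Ioc] with s hs
      exact Real.rpow_nonneg hs.1.le _

/-- For finite positive `x` this is an equality. For `x = ∞` the set is empty and the left side
vanishes, hence only an inequality in general. -/
theorem mul_setLIntegral_Ioi_indicator_le_rpow {p : ℝ} (hp : p < 1) (x : ℝ≥0∞) :
    x * ∫⁻ s in Ioi (0 : ℝ), {s : ℝ | x ≤ ENNReal.ofReal s}.indicator
      (fun s => ENNReal.ofReal (s ^ (p - 2))) s ≤ ENNReal.ofReal (1 / (1 - p)) * x ^ p := by
  rcases eq_or_ne x 0 with rfl | h0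
  · simp
  induction x with
  | top => simp
  | coe x =>
    have hx : 0 < (x : ℝ) := by exact_mod_cast pos_iff_ne_zero.2 h0
    have hset : {s : ℝ | (x : ℝ≥0∞) ≤ ENNReal.ofReal s} = Ici (x : ℝ) := by
      ext s
      rcases le_or_gt s 0 with h | h
      · simp only [ENNReal.ofReal_of_nonpos h, nonpos_iff_eq_zero, h0, Set.mem_ofPred_eq, mem_Ici,
          false_iff, not_le]
        exact lt_of_le_of_lt h hx
      · rw [Set.mem_ofPred_eq, mem_Ici, ← ENNReal.ofReal_coe_nnreal,
          ENNReal.ofReal_le_ofReal_iff h.le]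
    have hIci : Ici (x : ℝ) ∩ Ioi 0 = Ici (x : ℝ) :=
      inter_eq_left.2 fun s hs => lt_of_lt_of_le hx hs
    rw [hset, lintegral_indicator measurableSet_Ici, Measure.restrict_restrict measurableSet_Ici,
      hIci, setLIntegral_congr Ioi_ae_eq_Ici.symm,
      ← ofReal_integral_eq_lintegral_ofReal (integrableOn_Ioi_rpow_of_lt (by linarith) hx),
      integral_Ioi_rpow_of_lt (by linarith) hx]
    · rw [← ENNReal.ofReal_coe_nnreal, ENNReal.ofReal_rpow_of_pos hx, ← ENNReal.ofReal_mul hx.le,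
        ← ENNReal.ofReal_mul (by apply div_nonneg <;> linarith)]
      apply ENNReal.ofReal_le_ofReal
      have hpow : (x : ℝ) ^ p = x * x ^ (p - 2 + 1) := by
        nth_rw 2 [← Real.rpow_one (x : ℝ)]
        rw [← Real.rpow_add hx]; ring_nf
      rw [hpow]
      apply le_of_eq
      rw [show p - 2 + 1 = -(1 - p) by ring]
      have : 1 - p ≠ 0 := by linarith
      field_simp
    · filter_upwards [ae_restrict_mem measurableSet_Ioi] with s hs
      exact Real.rpow_nonneg (hx.trans hs).le _

section LayerCake

variable {X : Type*} [MeasurableSpace X] {μ : Measure X} [SFinite μ]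

/-- Layer cake formula with a weight. -/
theorem lintegral_Ioi_rpow_mul_setLIntegral_lt {p : ℝ} (hp : 0 < p) {f w : X → ℝ≥0∞}
    (hf : Measurable f) (hw : Measurable w) :
    ∫⁻ s in Ioi (0 : ℝ), ENNReal.ofReal (s ^ (p - 1)) * ∫⁻ x in {x | ENNReal.ofReal s < f x}, w x ∂μ
      = ENNReal.ofReal (1 / p) * ∫⁻ x, w x * f x ^ p ∂μ := by
  have hset : MeasurableSet {z : ℝ × X | ENNReal.ofReal z.1 < f z.2} :=
    measurableSet_lt (by fun_prop) (by fun_prop)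
  calc
    _ = ∫⁻ s in Ioi (0 : ℝ), ∫⁻ x, {z : ℝ × X | ENNReal.ofReal z.1 < f z.2}.indicator
          (fun z => ENNReal.ofReal (z.1 ^ (p - 1)) * w z.2) (s, x) ∂μ := by
      refine lintegral_congr fun s => ?_
      rw [← lintegral_indicator (measurableSet_lt (by fun_prop) hf),
        ← lintegral_const_mul _ (hw.indicator (measurableSet_lt (by fun_prop) hf))]
      refine lintegral_congr fun x => ?_
      by_cases h : ENNReal.ofReal s < f x <;> simp [indicator, h]
    _ = ∫⁻ x, ∫⁻ s in Ioi (0 : ℝ), {z : ℝ × X | ENNReal.ofReal z.1 < f z.2}.indicator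
          (fun z => ENNReal.ofReal (z.1 ^ (p - 1)) * w z.2) (s, x) ∂volume ∂μ := by
      refine lintegral_lintegral_swap (Measurable.aemeasurable ?_)
      exact Measurable.indicator (by fun_prop) hset
    _ = ∫⁻ x, w x * (ENNReal.ofReal (1 / p) * f x ^ p) ∂μ := by
      refine lintegral_congr fun x => ?_
      rw [← setLIntegral_Ioi_indicator_lt_rpow hp, ← lintegral_const_mul]
      · refine lintegral_congr fun s => ?_
        by_cases h : ENNReal.ofReal s < f x <;> simp [indicator, h, mul_comm]
      · exact Measurable.indicator (by fun_prop) (measurableSet_lt (by fun_prop) (by fun_prop))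
    _ = _ := by
      rw [← lintegral_const_mul _ (by fun_prop)]
      exact lintegral_congr fun x => by ring

/-- Counterpart of the layer cake formula for the part of `f` below the level; `p < 1` makes the
tail of `s ^ (p - 2)` integrable. -/
theorem lintegral_Ioi_rpow_mul_setLIntegral_le {p : ℝ} (hp : p < 1) {f : X → ℝ≥0∞}
    (hf : Measurable f) :
    ∫⁻ s in Ioi (0 : ℝ), ENNReal.ofReal (s ^ (p - 2)) * ∫⁻ x in {x | f x ≤ ENNReal.ofReal s}, f x ∂μ
      ≤ ENNReal.ofReal (1 / (1 - p)) * ∫⁻ x, f x ^ p ∂μ := by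
  have hset : MeasurableSet {z : ℝ × X | f z.2 ≤ ENNReal.ofReal z.1} :=
    measurableSet_le (by fun_prop) (by fun_prop)
  calc
    _ = ∫⁻ s in Ioi (0 : ℝ), ∫⁻ x, {z : ℝ × X | f z.2 ≤ ENNReal.ofReal z.1}.indicator
          (fun z => ENNReal.ofReal (z.1 ^ (p - 2)) * f z.2) (s, x) ∂μ := by
      refine lintegral_congr fun s => ?_
      rw [← lintegral_indicator (measurableSet_le hf (by fun_prop)),
        ← lintegral_const_mul _ (hf.indicator (measurableSet_le hf (by fun_prop)))]
      refine lintegral_congr fun x => ?_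
      by_cases h : f x ≤ ENNReal.ofReal s <;> simp [indicator, h]
    _ = ∫⁻ x, ∫⁻ s in Ioi (0 : ℝ), {z : ℝ × X | f z.2 ≤ ENNReal.ofReal z.1}.indicator
          (fun z => ENNReal.ofReal (z.1 ^ (p - 2)) * f z.2) (s, x) ∂volume ∂μ := by
      refine lintegral_lintegral_swap (Measurable.aemeasurable ?_)
      exact Measurable.indicator (by fun_prop) hset
    _ ≤ ∫⁻ x, ENNReal.ofReal (1 / (1 - p)) * f x ^ p ∂μ := by
      refine lintegral_mono fun x => ?_
      refine le_trans (le_of_eq ?_) (mul_setLIntegral_Ioi_indicator_le_rpow hp (f x))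
      rw [← lintegral_const_mul]
      · refine lintegral_congr fun s => ?_
        by_cases h : f x ≤ ENNReal.ofReal s <;> simp [indicator, h, mul_comm]
      · exact Measurable.indicator (by fun_prop) (measurableSet_le (by fun_prop) (by fun_prop))
    _ = _ := lintegral_const_mul _ (by fun_prop)

end LayerCake

/-! ### The Hardy–Littlewood maximal function: weak type (1,1) and strong type. -/

section Maximal

variable {E : Type*} [NormedAddCommGroup E] [NormedSpace ℝ E] [FiniteDimensional ℝ E]
  [MeasurableSpace E] [BorelSpace E] (μ : Measure E) [μ.IsAddHaarMeasure]

/-- The Hardy–Littlewood maximal function, over centred closed balls of rational radius. -/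
noncomputable def centredMaximal (f : E → ℝ≥0∞) (x : E) : ℝ≥0∞ :=
  ⨆ r : {r : ℚ // 0 < r}, (∫⁻ y in closedBall x (r : ℚ), f y ∂μ) / μ (closedBall x (r : ℚ))

theorem measurable_setLIntegral_closedBall {f : E → ℝ≥0∞} (hf : Measurable f) (r : ℝ) :
    Measurable fun x => ∫⁻ y in closedBall x r, f y ∂μ := by
  have h : (fun x => ∫⁻ y in closedBall x r, f y ∂μ) =
      fun x => ∫⁻ y, {z : E × E | dist z.2 z.1 ≤ r}.indicator (fun z => f z.2) (x, y) ∂μ := by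
    ext x
    rw [← lintegral_indicator measurableSet_closedBall]
    rfl
  rw [h]
  refine Measurable.lintegral_prod_right' (f := {z : E × E | dist z.2 z.1 ≤ r}.indicator
    (fun z => f z.2)) ?_
  exact Measurable.indicator (by fun_prop) (measurableSet_le (by fun_prop) (by fun_prop))

/-- Rational radii make the supremum countable, and the measure of a ball does not depend on its
centre. -/
theorem measurable_centredMaximal {f : E → ℝ≥0∞} (hf : Measurable f) :
    Measurable (centredMaximal μ f) := by
  refine Measurable.iSup fun r => ?_
  have hr : (0 : ℝ) ≤ ((r : ℚ) : ℝ) := by exact_mod_cast r.2.le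
  simp_rw [Measure.addHaar_closedBall μ _ hr]
  exact (measurable_setLIntegral_closedBall μ hf _).div_const _

/-- Enlarging to a rational radius in `(t, 2t)` costs the factor `2 ^ dim`. -/
theorem setLIntegral_ball_le_centredMaximal (f : E → ℝ≥0∞) (x : E) {t : ℝ} (ht : 0 < t) :
    ∫⁻ y in ball x t, f y ∂μ ≤
      2 ^ Module.finrank ℝ E * μ (ball x t) * centredMaximal μ f x := by
  obtain ⟨r, hr1, hr2⟩ := exists_rat_btwn (show t < 2 * t by linarith)
  have hr : 0 < r := by exact_mod_cast ht.trans hr1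
  have hrR : (0 : ℝ) < r := by exact_mod_cast hr
  have hB0 : μ (closedBall x r) ≠ 0 := (measure_closedBall_pos μ x hrR).ne'
  have hBt : μ (closedBall x r) ≠ ∞ := measure_closedBall_lt_top.ne
  have hB : μ (closedBall x r) ≤ 2 ^ Module.finrank ℝ E * μ (ball x t) := by
    rw [Measure.addHaar_closedBall μ x hrR.le, ← mul_one t, Measure.addHaar_ball_mul_of_pos μ x ht,
      ← mul_assoc]
    gcongr
    rw [ENNReal.ofReal_pow hrR.le, ENNReal.ofReal_pow ht.le, ← mul_pow]
    gcongr
    rw [← ENNReal.ofReal_ofNat, ← ENNReal.ofReal_mul (by norm_num)]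
    exact ENNReal.ofReal_le_ofReal hr2.le
  calc
    ∫⁻ y in ball x t, f y ∂μ ≤ ∫⁻ y in closedBall x r, f y ∂μ :=
      lintegral_mono_set (ball_subset_closedBall.trans (closedBall_subset_closedBall hr1.le))
    _ = μ (closedBall x r) * ((∫⁻ y in closedBall x r, f y ∂μ) / μ (closedBall x r)) :=
      (ENNReal.mul_div_cancel hB0 hBt).symm
    _ ≤ _ := by
      gcongr
      exact le_iSup (fun r : {r : ℚ // 0 < r} =>
        (∫⁻ y in closedBall x (r : ℚ), f y ∂μ) / μ (closedBall x (r : ℚ))) ⟨r, hr⟩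

/-- Vitali covering bound for points admitting a ball of bounded radius with large average. -/
theorem measure_mul_le_of_forall_exists_closedBall {f : E → ℝ≥0∞} {U : Set E} {c : ℝ≥0∞} {R : ℝ}
    (hU : ∀ x ∈ U, ∃ r, 0 < r ∧ r ≤ R ∧
      c * μ (closedBall x r) ≤ ∫⁻ y in closedBall x r, f y ∂μ) :
    c * μ U ≤ 5 ^ Module.finrank ℝ E * ∫⁻ y, f y ∂μ := by
  choose! r hr0 hrR hr using hU
  obtain ⟨u, huU, hdisj, hcov⟩ := Vitali.exists_disjoint_subfamily_covering_enlargement_closedBall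
    U id r R hrR 5 (by norm_num)
  simp only [id] at hdisj hcov
  have hcount : u.Countable := hdisj.countable_of_nonempty_interior fun x hx =>
    (nonempty_ball.2 (hr0 x (huU hx))).mono ball_subset_interior_closedBall
  have hsub : U ⊆ ⋃ b ∈ u, closedBall b (5 * r b) := fun x hx => by
    obtain ⟨b, hb, h⟩ := hcov x hx
    exact mem_iUnion₂.2 ⟨b, hb, h (mem_closedBall_self (hr0 x hx).le)⟩
  have := hcount.to_subtype
  calc
    c * μ U ≤ c * ∑' b : u, μ (closedBall (b : E) (5 * r b)) := by
      gcongr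
      exact (measure_mono hsub).trans (measure_biUnion_le μ hcount _)
    _ = 5 ^ Module.finrank ℝ E * ∑' b : u, c * μ (closedBall (b : E) (r b)) := by
      rw [← ENNReal.tsum_mul_left, ← ENNReal.tsum_mul_left]
      refine tsum_congr fun b => ?_
      have hb := (hr0 b (huU b.2)).le
      rw [Measure.addHaar_closedBall_mul μ _ (by norm_num) hb,
        Measure.addHaar_closedBall_center μ (b : E), ENNReal.ofReal_pow (by norm_num),
        ENNReal.ofReal_ofNat]
      ring
    _ ≤ 5 ^ Module.finrank ℝ E * ∑' b : u, ∫⁻ y in closedBall (b : E) (r b), f y ∂μ := by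
      gcongr with b
      exact hr b (huU b.2)
    _ = 5 ^ Module.finrank ℝ E * ∫⁻ y in ⋃ b ∈ u, closedBall b (r b), f y ∂μ := by
      rw [lintegral_biUnion hcount (fun _ _ => measurableSet_closedBall) hdisj]
    _ ≤ _ := by
      exact mul_le_mul_right (setLIntegral_le_lintegral _ _) _

/-- Weak type (1,1) bound for the maximal function. -/
theorem mul_measure_lt_centredMaximal_le (f : E → ℝ≥0∞) (c : ℝ≥0∞) :
    c * μ {x | c < centredMaximal μ f x} ≤ 5 ^ Module.finrank ℝ E * ∫⁻ y, f y ∂μ := by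
  -- The Vitali covering needs bounded radii; the bound is uniform in `N`, so it passes to the
  -- increasing union.
  set U : ℕ → Set E := fun N => {x | ∃ r : ℝ, 0 < r ∧ r ≤ N ∧
      c * μ (closedBall x r) ≤ ∫⁻ y in closedBall x r, f y ∂μ} with hUdef
  have hmono : Monotone U := fun N M hNM x ⟨r, h0, h1, h2⟩ =>
    ⟨r, h0, h1.trans (by exact_mod_cast hNM), h2⟩
  have hsub : {x | c < centredMaximal μ f x} ⊆ ⋃ N, U N := by
    intro x hx
    obtain ⟨r, hr⟩ := lt_iSup_iff.1 (show c < _ from hx)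
    have hr0 : (0 : ℝ) < ((r : ℚ) : ℝ) := by exact_mod_cast r.2
    obtain ⟨N, hN⟩ := exists_nat_ge ((r : ℚ) : ℝ)
    refine mem_iUnion.2 ⟨N, (r : ℚ), hr0, hN, ?_⟩
    exact (ENNReal.le_div_iff_mul_le (Or.inl (measure_closedBall_pos μ x hr0).ne')
      (Or.inl measure_closedBall_lt_top.ne)).1 hr.le
  calc
    _ ≤ c * μ (⋃ N, U N) := by gcongr
    _ = ⨆ N, c * μ (U N) := by rw [hmono.measure_iUnion, ENNReal.mul_iSup]
    _ ≤ _ := iSup_le fun N => measure_mul_le_of_forall_exists_closedBall μ (R := N) fun x hx => hx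

-- Cutting `f` at height `c` leaves a remainder at most `c`, whose averages are at most `c`.
omit [BorelSpace E] in
theorem centredMaximal_le_add (f : E → ℝ≥0∞) (c : ℝ≥0∞) (x : E) :
    centredMaximal μ f x ≤ centredMaximal μ ({x | c < f x}.indicator f) x + c := by
  refine iSup_le fun r => ?_
  have hr0 : (0 : ℝ) < ((r : ℚ) : ℝ) := by exact_mod_cast r.2
  have hB0 : μ (closedBall x (r : ℚ)) ≠ 0 := (measure_closedBall_pos μ x hr0).ne'
  have hBt : μ (closedBall x (r : ℚ)) ≠ ∞ := measure_closedBall_lt_top.ne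
  calc
    _ ≤ (∫⁻ y in closedBall x (r : ℚ), {x | c < f x}.indicator f y + c ∂μ) /
          μ (closedBall x (r : ℚ)) := by
      gcongr with y
      by_cases h : c < f y
      · simp [indicator, h]
      · exact (not_lt.1 h).trans le_add_self
    _ = (∫⁻ y in closedBall x (r : ℚ), {x | c < f x}.indicator f y ∂μ) /
          μ (closedBall x (r : ℚ)) + c := by
      rw [lintegral_add_right _ measurable_const, setLIntegral_const, ENNReal.add_div,
        ENNReal.mul_div_cancel_right hB0 hBt]
    _ ≤ _ := by
      gcongr
      exact le_iSup (fun r : {r : ℚ // 0 < r} => (∫⁻ y in closedBall x (r : ℚ),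
        {x | c < f x}.indicator f y ∂μ) / μ (closedBall x (r : ℚ))) r

/-- Hardy–Littlewood maximal theorem for exponents `r > 1`. -/
theorem exists_lintegral_centredMaximal_rpow_le {r : ℝ} (hr : 1 < r) :
    ∃ C : ℝ≥0∞, C ≠ ∞ ∧ ∀ f : E → ℝ≥0∞, Measurable f →
      ∫⁻ x, centredMaximal μ f x ^ r ∂μ ≤ C * ∫⁻ x, f x ^ r ∂μ := by
  set A : ℝ≥0∞ := 2 * 5 ^ Module.finrank ℝ E with hA
  set B : ℝ≥0∞ := ENNReal.ofReal (1 / (r - 1)) * 2 ^ (r - 1) with hB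
  have hr0 : 0 < r := by linarith
  refine ⟨ENNReal.ofReal r * (A * B), by finiteness, fun f hf => ?_⟩
  have hM := measurable_centredMaximal μ hf
  have hlevel : ∀ s : ℝ, 0 < s → μ {x | ENNReal.ofReal s < centredMaximal μ f x} ≤
      A * ENNReal.ofReal (s⁻¹) * ∫⁻ x in {x | ENNReal.ofReal s < 2 * f x}, f x ∂μ := by
    intro s hs
    -- Cutting at half the level: `Mf > s` forces the maximal function of the part of `f` above `s /
    -- 2` to exceed `s / 2`. The condition `f > s / 2` is kept as `s < 2 * f`, so that the weighted
    -- layer cake applies to `2 * f` with weight `f`.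
    set c := ENNReal.ofReal (s / 2) with hc
    have hcs : ENNReal.ofReal s = c + c := by
      rw [hc, ← ENNReal.ofReal_add (by positivity) (by positivity), add_halves]
    have hset : {x | c < f x} = {x | ENNReal.ofReal s < 2 * f x} := by
      ext x
      simp only [Set.mem_ofPred_eq]
      rw [hcs, ← two_mul, ENNReal.mul_lt_mul_iff_right (by norm_num) (by norm_num)]
    have hweak := mul_measure_lt_centredMaximal_le μ ({x | c < f x}.indicator f) c
    rw [lintegral_indicator (measurableSet_lt (by fun_prop) hf), hset] at hweak
    have hsub : μ {x | ENNReal.ofReal s < centredMaximal μ f x} ≤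
        μ {x | c < centredMaximal μ ({x | c < f x}.indicator f) x} := by
      refine measure_mono fun x hx => ?_
      have h1 : c + c < centredMaximal μ ({x | c < f x}.indicator f) x + c := by
        rw [← hcs]
        exact lt_of_lt_of_le hx (centredMaximal_le_add μ f c x)
      exact lt_of_add_lt_add_right h1
    have hinv : ENNReal.ofReal s⁻¹ * 2 * c = 1 := by
      rw [hc, mul_assoc, ← ENNReal.ofReal_ofNat, ← ENNReal.ofReal_mul (by norm_num),
        ← ENNReal.ofReal_mul (by positivity), show s⁻¹ * (2 * (s / 2)) = 1 by field_simp]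
      simp
    rw [hset] at hsub
    calc
      _ ≤ _ := hsub
      _ = ENNReal.ofReal s⁻¹ * 2 * (c * μ {x | c < centredMaximal μ
            ({x | ENNReal.ofReal s < 2 * f x}.indicator f) x}) := by
        rw [← mul_assoc, hinv, one_mul]
      _ ≤ ENNReal.ofReal s⁻¹ * 2 * (5 ^ Module.finrank ℝ E *
            ∫⁻ x in {x | ENNReal.ofReal s < 2 * f x}, f x ∂μ) := by gcongr
      _ = _ := by rw [hA]; ring
  have hlay := lintegral_Ioi_rpow_mul_setLIntegral_lt (μ := μ) hr0 hM (w := fun _ => 1)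
    measurable_const
  simp only [setLIntegral_const, one_mul] at hlay
  have hlay2 := lintegral_Ioi_rpow_mul_setLIntegral_lt (μ := μ) (show 0 < r - 1 by linarith)
    (f := fun x => 2 * f x) (by fun_prop) hf
  have hrr : ENNReal.ofReal r * ENNReal.ofReal (1 / r) = 1 := by
    rw [← ENNReal.ofReal_mul hr0.le, mul_one_div_cancel hr0.ne', ENNReal.ofReal_one]
  calc
    ∫⁻ x, centredMaximal μ f x ^ r ∂μ
      = ENNReal.ofReal r * ∫⁻ s in Ioi (0 : ℝ), ENNReal.ofReal (s ^ (r - 1)) *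
          μ {x | ENNReal.ofReal s < centredMaximal μ f x} := by
        rw [hlay, ← mul_assoc, hrr, one_mul]
    _ ≤ ENNReal.ofReal r * ∫⁻ s in Ioi (0 : ℝ), A * (ENNReal.ofReal (s ^ (r - 1 - 1)) *
          ∫⁻ x in {x | ENNReal.ofReal s < 2 * f x}, f x ∂μ) := by
        refine mul_le_mul_right (setLIntegral_mono' measurableSet_Ioi fun s hs => ?_) _
        have hs : 0 < s := hs
        calc
          _ ≤ ENNReal.ofReal (s ^ (r - 1)) * (A * ENNReal.ofReal (s⁻¹) *
                ∫⁻ x in {x | ENNReal.ofReal s < 2 * f x}, f x ∂μ) := by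
            gcongr; exact hlevel s hs
          _ = _ := by
            rw [Real.rpow_sub_one hs.ne' (r - 1), div_eq_mul_inv,
              ENNReal.ofReal_mul (by positivity)]
            ring
    _ = ENNReal.ofReal r * (A * (ENNReal.ofReal (1 / (r - 1)) *
          ∫⁻ x, f x * (2 * f x) ^ (r - 1) ∂μ)) := by
        rw [lintegral_const_mul' _ _ (by finiteness), hlay2]
    _ = ENNReal.ofReal r * (A * (ENNReal.ofReal (1 / (r - 1)) *
          ∫⁻ x, 2 ^ (r - 1) * f x ^ r ∂μ)) := by
        congr 3
        refine lintegral_congr fun x => ?_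
        rw [ENNReal.mul_rpow_of_nonneg _ _ (by linarith)]
        have : f x ^ r = f x * f x ^ (r - 1) := by
          nth_rw 2 [← ENNReal.rpow_one (f x)]
          rw [← ENNReal.rpow_add_of_nonneg _ _ (by norm_num) (by linarith)]
          ring_nf
        rw [this]; ring
    _ = _ := by
        rw [lintegral_const_mul _ (by fun_prop), hB]
        ring

end Maximal

/-! ### Cone and vertical integrals tested against a weight. -/

section SquareFunctions

variable {n : ℕ}

/-- The square of the conical square function, for a density `H` in place of `|g|²`. -/
noncomputable def coneIntegral (H : ℝ × EuclideanSpace ℝ (Fin n) → ℝ≥0∞)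
    (x : EuclideanSpace ℝ (Fin n)) : ℝ≥0∞ :=
  ∫⁻ z in upperHalfSpace n,
    (ball x z.1).indicator (fun _ => (1 : ℝ≥0∞)) z.2 / ENNReal.ofReal z.1 ^ n
      * H z / ENNReal.ofReal z.1

/-- The square of the vertical square function, for a density `H` in place of `|g|²`. -/
noncomputable def vertIntegral (H : ℝ × EuclideanSpace ℝ (Fin n) → ℝ≥0∞)
    (x : EuclideanSpace ℝ (Fin n)) : ℝ≥0∞ :=
  ∫⁻ t in Ioi (0 : ℝ), H (t, x) / ENNReal.ofReal t

theorem volume_restrict_upperHalfSpace :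
    (volume : Measure (ℝ × EuclideanSpace ℝ (Fin n))).restrict (upperHalfSpace n) =
      (volume.restrict (Ioi 0)).prod volume := by
  have h : upperHalfSpace n = Ioi (0 : ℝ) ×ˢ (univ : Set (EuclideanSpace ℝ (Fin n))) := by
    ext z; simp [upperHalfSpace]
  rw [h, Measure.volume_eq_prod, ← Measure.prod_restrict, Measure.restrict_univ]

theorem measurable_cone_kernel {H : ℝ × EuclideanSpace ℝ (Fin n) → ℝ≥0∞} (hH : Measurable H) :
    Measurable fun w : EuclideanSpace ℝ (Fin n) × (ℝ × EuclideanSpace ℝ (Fin n)) =>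
      (ball w.1 w.2.1).indicator (fun _ => (1 : ℝ≥0∞)) w.2.2 / ENNReal.ofReal w.2.1 ^ n
        * H w.2 / ENNReal.ofReal w.2.1 := by
  have h : Measurable fun w : EuclideanSpace ℝ (Fin n) × (ℝ × EuclideanSpace ℝ (Fin n)) =>
      (ball w.1 w.2.1).indicator (fun _ => (1 : ℝ≥0∞)) w.2.2 :=
    Measurable.indicator (s := {w : EuclideanSpace ℝ (Fin n) × (ℝ × EuclideanSpace ℝ (Fin n)) |
      dist w.2.2 w.1 < w.2.1}) measurable_const (measurableSet_lt (by fun_prop) (by fun_prop))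
  fun_prop

theorem measurable_coneIntegral {H : ℝ × EuclideanSpace ℝ (Fin n) → ℝ≥0∞} (hH : Measurable H) :
    Measurable (coneIntegral H) :=
  (measurable_cone_kernel hH).lintegral_prod_right'

theorem measurable_vertIntegral {H : ℝ × EuclideanSpace ℝ (Fin n) → ℝ≥0∞} (hH : Measurable H) :
    Measurable (vertIntegral H) := by
  refine Measurable.lintegral_prod_right'
    (f := fun w : EuclideanSpace ℝ (Fin n) × ℝ => H (w.2, w.1) / ENNReal.ofReal w.2) ?_
  fun_prop

theorem lintegral_mul_coneIntegral {H : ℝ × EuclideanSpace ℝ (Fin n) → ℝ≥0∞} (hH : Measurable H)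
    {φ : EuclideanSpace ℝ (Fin n) → ℝ≥0∞} (hφ : Measurable φ) :
    ∫⁻ x, φ x * coneIntegral H x = ∫⁻ y, ∫⁻ t in Ioi (0 : ℝ),
      (∫⁻ x in ball y t, φ x) / ENNReal.ofReal t ^ n * (H (t, y) / ENNReal.ofReal t) := by
  have hk := measurable_cone_kernel hH
  set k := fun w : EuclideanSpace ℝ (Fin n) × (ℝ × EuclideanSpace ℝ (Fin n)) =>
      (ball w.1 w.2.1).indicator (fun _ => (1 : ℝ≥0∞)) w.2.2 / ENNReal.ofReal w.2.1 ^ n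
        * H w.2 / ENNReal.ofReal w.2.1 with hkdef
  have hm : Measurable fun w => φ w.1 * k w := (hφ.comp measurable_fst).mul hk
  have hinner : ∀ z : ℝ × EuclideanSpace ℝ (Fin n), ∫⁻ x, φ x * k (x, z) =
      (∫⁻ x in ball z.2 z.1, φ x) / ENNReal.ofReal z.1 ^ n * (H z / ENNReal.ofReal z.1) := by
    intro z
    rw [← lintegral_indicator measurableSet_ball, ENNReal.div_eq_inv_mul, mul_comm (_⁻¹) _,
      mul_assoc, ← lintegral_mul_const _ (hφ.indicator measurableSet_ball)]
    refine lintegral_congr fun x => ?_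
    by_cases h : dist x z.2 < z.1
    · have h' : dist z.2 x < z.1 := by rwa [dist_comm]
      simp only [hkdef, indicator, mem_ball, h, h', if_true, div_eq_mul_inv]
      ring
    · have h' : ¬ dist z.2 x < z.1 := by rwa [dist_comm]
      simp [hkdef, indicator, h, h']
  calc
    ∫⁻ x, φ x * coneIntegral H x = ∫⁻ x, ∫⁻ z in upperHalfSpace n, φ x * k (x, z) :=
      lintegral_congr fun x => (lintegral_const_mul _ (hk.comp measurable_prodMk_left)).symm
    _ = ∫⁻ z in upperHalfSpace n, ∫⁻ x, φ x * k (x, z) :=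
      lintegral_lintegral_swap hm.aemeasurable
    _ = ∫⁻ z in upperHalfSpace n,
        (∫⁻ x in ball z.2 z.1, φ x) / ENNReal.ofReal z.1 ^ n * (H z / ENNReal.ofReal z.1) :=
      lintegral_congr hinner
    _ = _ := by
      rw [volume_restrict_upperHalfSpace, lintegral_prod_symm']
      simp_rw [← hinner]
      exact hm.lintegral_prod_left'

theorem volume_ball_eq_pow_mul (x : EuclideanSpace ℝ (Fin n)) {t : ℝ} (ht : 0 < t) :
    volume (ball x t) = ENNReal.ofReal t ^ n * volume (ball (0 : EuclideanSpace ℝ (Fin n)) 1) := by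
  have := Measure.addHaar_ball_mul_of_pos volume x ht 1
  rwa [mul_one, finrank_euclideanSpace_fin, ENNReal.ofReal_pow ht.le] at this

theorem lintegral_coneIntegral {H : ℝ × EuclideanSpace ℝ (Fin n) → ℝ≥0∞} (hH : Measurable H) :
    ∫⁻ x, coneIntegral H x =
      volume (ball (0 : EuclideanSpace ℝ (Fin n)) 1) * ∫⁻ x, vertIntegral H x := by
  have h := lintegral_mul_coneIntegral hH (φ := fun _ => 1) measurable_const
  simp only [one_mul] at h
  rw [h, ← lintegral_const_mul _ (measurable_vertIntegral hH)]
  refine lintegral_congr fun y => ?_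
  rw [vertIntegral, ← lintegral_const_mul _ (by fun_prop)]
  refine setLIntegral_congr_fun measurableSet_Ioi fun t ht => ?_
  have ht : 0 < t := ht
  simp only [setLIntegral_one]
  rw [volume_ball_eq_pow_mul y ht, mul_comm (_ ^ n), ENNReal.mul_div_cancel_right]
  · exact pow_ne_zero _ (by simpa using ht)
  · finiteness

/-- In the Tonelli identity the mean of `φ` over `B(y,t)` is bounded, uniformly in `t`, by the
maximal function at the centre `y`. -/
theorem lintegral_mul_coneIntegral_le {H : ℝ × EuclideanSpace ℝ (Fin n) → ℝ≥0∞} (hH : Measurable H)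
    {φ : EuclideanSpace ℝ (Fin n) → ℝ≥0∞} (hφ : Measurable φ) :
    ∫⁻ x, φ x * coneIntegral H x ≤ 2 ^ n * volume (ball (0 : EuclideanSpace ℝ (Fin n)) 1) *
      ∫⁻ x, vertIntegral H x * centredMaximal volume φ x := by
  have hV := measurable_vertIntegral hH
  have hM := measurable_centredMaximal volume hφ
  rw [lintegral_mul_coneIntegral hH hφ, ← lintegral_const_mul _ (by fun_prop)]
  refine lintegral_mono fun y => ?_
  rw [mul_comm (vertIntegral H y), ← mul_assoc, vertIntegral, ← lintegral_const_mul _ (by fun_prop)]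
  refine setLIntegral_mono' measurableSet_Ioi fun t ht => ?_
  have ht : 0 < t := ht
  gcongr
  have h := setLIntegral_ball_le_centredMaximal volume φ y ht
  rw [finrank_euclideanSpace_fin, volume_ball_eq_pow_mul y ht] at h
  refine ENNReal.div_le_of_le_mul (h.trans (le_of_eq ?_))
  ring

/-- The Tonelli identity with `φ` the indicator of `Oᶜ`. The threshold `(2 * 2 ^ n)⁻¹` absorbs the
loss `2 ^ n` in `setLIntegral_ball_le_centredMaximal`, so `Oᶜ` fills at least half of each `B(y,t)`.
-/
theorem setLIntegral_vertIntegral_le {H : ℝ × EuclideanSpace ℝ (Fin n) → ℝ≥0∞} (hH : Measurable H)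
    {O : Set (EuclideanSpace ℝ (Fin n))} (hO : MeasurableSet O) :
    ∫⁻ x in {x | centredMaximal volume (O.indicator fun _ => 1) x ≤ (2 * 2 ^ n)⁻¹},
      vertIntegral H x ≤
    2 * (volume (ball (0 : EuclideanSpace ℝ (Fin n)) 1))⁻¹ * ∫⁻ x in Oᶜ, coneIntegral H x := by
  have h1 : Measurable (O.indicator fun _ => (1 : ℝ≥0∞)) := measurable_const.indicator hO
  have hMm := measurable_centredMaximal volume h1
  have hset : MeasurableSet {x | centredMaximal volume (O.indicator fun _ => 1) x
      ≤ (2 * 2 ^ n)⁻¹} := measurableSet_le hMm measurable_const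
  have hω0 : volume (ball (0 : EuclideanSpace ℝ (Fin n)) 1) ≠ 0 :=
    (measure_ball_pos _ _ one_pos).ne'
  have hωt : volume (ball (0 : EuclideanSpace ℝ (Fin n)) 1) ≠ ∞ := measure_ball_lt_top.ne
  set ω := volume (ball (0 : EuclideanSpace ℝ (Fin n)) 1) with hω
  have hφ : Measurable (Oᶜ.indicator fun _ => (1 : ℝ≥0∞)) := measurable_const.indicator hO.compl
  have hE : ∫⁻ x in Oᶜ, coneIntegral H x =
      ∫⁻ x, (Oᶜ.indicator fun _ => (1 : ℝ≥0∞)) x * coneIntegral H x := by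
    rw [← lintegral_indicator hO.compl]
    refine lintegral_congr fun x => ?_
    by_cases h : x ∈ O <;> simp [h]
  rw [hE, lintegral_mul_coneIntegral hH hφ, ← lintegral_const_mul' _ _ (by finiteness)]
  refine le_trans (setLIntegral_mono_ae' hset (ae_of_all _ fun y hy => ?_))
    (setLIntegral_le_lintegral _ _)
  rw [vertIntegral, ← lintegral_const_mul' _ _ (by finiteness)]
  refine setLIntegral_mono' measurableSet_Ioi fun t ht => ?_
  have ht : 0 < t := ht
  have htn0 : ENNReal.ofReal t ^ n ≠ 0 := pow_ne_zero _ (by simpa using ht)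
  have htnt : ENNReal.ofReal t ^ n ≠ ∞ := by finiteness
  have hsmall : volume (O ∩ ball y t) ≤ volume (ball y t) / 2 := by
    have h := setLIntegral_ball_le_centredMaximal volume (O.indicator fun _ => (1 : ℝ≥0∞)) y ht
    rw [lintegral_indicator hO, Measure.restrict_restrict hO, setLIntegral_one,
      finrank_euclideanSpace_fin] at h
    refine h.trans ((mul_le_mul_right hy _).trans (le_of_eq ?_))
    rw [ENNReal.mul_inv (by simp) (by simp), mul_comm (2 ^ n) (volume _), mul_assoc,
      mul_comm (2⁻¹) _, ← mul_assoc (2 ^ n), ENNReal.mul_inv_cancel (by simp) (by finiteness),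
      one_mul, ENNReal.div_eq_inv_mul, mul_comm]
  have hbig : volume (ball y t) / 2 ≤ volume (Oᶜ ∩ ball y t) := by
    have hBt : volume (ball y t) ≠ ∞ := measure_ball_lt_top.ne
    have h := measure_inter_add_sdiff (μ := volume) (ball y t) hO
    rw [inter_comm, sdiff_eq, inter_comm (ball y t)] at h
    have h2 : volume (ball y t) / 2 + volume (ball y t) / 2 ≤
        volume (ball y t) / 2 + volume (Oᶜ ∩ ball y t) := by
      rw [ENNReal.add_halves]
      calc volume (ball y t) = volume (O ∩ ball y t) + volume (Oᶜ ∩ ball y t) := h.symm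
        _ ≤ _ := by gcongr
    exact (ENNReal.add_le_add_iff_left (by finiteness)).1 h2
  rw [lintegral_indicator hO.compl, Measure.restrict_restrict hO.compl, setLIntegral_one,
    ← mul_assoc]
  refine le_trans (le_of_eq (one_mul _).symm) (mul_le_mul_left ?_ _)
  calc (1 : ℝ≥0∞) = 2 * ω⁻¹ * (volume (ball y t) / 2 / ENNReal.ofReal t ^ n) := by
        rw [volume_ball_eq_pow_mul y ht, ← hω]
        simp only [div_eq_mul_inv]
        calc (1 : ℝ≥0∞) = (2 * 2⁻¹) * (ω * ω⁻¹) *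
              (ENNReal.ofReal t ^ n * (ENNReal.ofReal t ^ n)⁻¹) := by
              rw [ENNReal.mul_inv_cancel htn0 htnt, ENNReal.mul_inv_cancel hω0 hωt,
                ENNReal.mul_inv_cancel (by simp) (by simp)]
              simp
          _ = _ := by ring
    _ ≤ _ := by gcongr

end SquareFunctions

/-! ### Comparison of the two integrals for `q < 1` and `q > 1`. -/

section Comparison

variable {n : ℕ}

theorem exists_lintegral_vertIntegral_rpow_le (n : ℕ) {q : ℝ} (hq0 : 0 < q) (hq1 : q < 1) :
    ∃ C : ℝ≥0∞, C ≠ ∞ ∧ ∀ H : ℝ × EuclideanSpace ℝ (Fin n) → ℝ≥0∞, Measurable H →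
      ∫⁻ x, vertIntegral H x ^ q ≤ C * ∫⁻ x, coneIntegral H x ^ q := by
  set ω := volume (ball (0 : EuclideanSpace ℝ (Fin n)) 1) with hω
  have hω0 : ω ≠ 0 := (measure_ball_pos _ _ one_pos).ne'
  set A : ℝ≥0∞ := 2 * 2 ^ n * 5 ^ n with hA
  set B : ℝ≥0∞ := 2 * ω⁻¹ with hB
  have hBt : B ≠ ∞ := by finiteness
  refine ⟨ENNReal.ofReal q * (A * ENNReal.ofReal (1 / q) + B * ENNReal.ofReal (1 / (1 - q))),
    by finiteness, fun H hH => ?_⟩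
  have hF := measurable_vertIntegral hH
  have hG := measurable_coneIntegral hH
  -- The level set of `F` is split along `W`, the points where `O` is sparse at every scale: weak
  -- type controls `Wᶜ`, Chebyshev the rest.
  have hlevel : ∀ s : ℝ, 0 < s → volume {x | ENNReal.ofReal s < vertIntegral H x} ≤
      A * volume {x | ENNReal.ofReal s < coneIntegral H x} +
        B * ENNReal.ofReal s⁻¹ * ∫⁻ x in {x | coneIntegral H x ≤ ENNReal.ofReal s},
          coneIntegral H x := by
    intro s hs
    set O := {x | ENNReal.ofReal s < coneIntegral H x} with hOdef
    have hO : MeasurableSet O := measurableSet_lt measurable_const hG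
    have hOc : Oᶜ = {x | coneIntegral H x ≤ ENNReal.ofReal s} := by
      ext x; simp [hOdef]
    set W := {x | centredMaximal volume (O.indicator fun _ => 1) x ≤ (2 * 2 ^ n)⁻¹} with hW
    have hWc : volume Wᶜ ≤ A * volume O := by
      have h := mul_measure_lt_centredMaximal_le volume (O.indicator fun _ => (1 : ℝ≥0∞))
        (2 * 2 ^ n)⁻¹
      rw [lintegral_indicator hO, setLIntegral_one, finrank_euclideanSpace_fin] at h
      have hWc' : Wᶜ = {x | (2 * 2 ^ n)⁻¹ <
          centredMaximal volume (O.indicator fun _ => (1 : ℝ≥0∞)) x} := by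
        ext x; simp only [hW, mem_compl_iff, Set.mem_ofPred_eq, not_le]
      rw [hWc']
      calc _ = 2 * 2 ^ n * ((2 * 2 ^ n)⁻¹ * volume {x | (2 * 2 ^ n)⁻¹ <
          centredMaximal volume (O.indicator fun _ => (1 : ℝ≥0∞)) x}) := by
            rw [← mul_assoc, ENNReal.mul_inv_cancel (by simp) (by finiteness), one_mul]
        _ ≤ 2 * 2 ^ n * (5 ^ n * volume O) := by gcongr
        _ = _ := by rw [hA]; ring
    have hWm : MeasurableSet W :=
      measurableSet_le (measurable_centredMaximal volume (measurable_const.indicator hO))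
        measurable_const
    have hcheb : volume ({x | ENNReal.ofReal s < vertIntegral H x} ∩ W) ≤
        ENNReal.ofReal s⁻¹ * ∫⁻ x in W, vertIntegral H x := by
      have h := mul_meas_ge_le_lintegral (μ := volume.restrict W) hF (ENNReal.ofReal s)
      have hlt : {x | ENNReal.ofReal s < vertIntegral H x} ⊆
          {x | ENNReal.ofReal s ≤ vertIntegral H x} := fun x hx => by
        simpa only [Set.mem_ofPred_eq] using le_of_lt (by simpa only [Set.mem_ofPred_eq] using hx)
      calc _ ≤ volume ({x | ENNReal.ofReal s ≤ vertIntegral H x} ∩ W) :=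
            measure_mono (inter_subset_inter_left _ hlt)
        _ = ENNReal.ofReal s⁻¹ * (ENNReal.ofReal s *
              volume ({x | ENNReal.ofReal s ≤ vertIntegral H x} ∩ W)) := by
            rw [← mul_assoc, ← ENNReal.ofReal_mul (by positivity), inv_mul_cancel₀ hs.ne',
              ENNReal.ofReal_one, one_mul]
        _ ≤ _ := by
            rw [Measure.restrict_apply (measurableSet_le measurable_const hF)] at h
            exact mul_le_mul_right h _
    have hsub : {x | ENNReal.ofReal s < vertIntegral H x} ⊆
        Wᶜ ∪ {x | ENNReal.ofReal s < vertIntegral H x} ∩ W := fun x hx => by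
      by_cases h : x ∈ W
      · exact Or.inr ⟨hx, h⟩
      · exact Or.inl h
    calc _ ≤ volume Wᶜ + volume ({x | ENNReal.ofReal s < vertIntegral H x} ∩ W) :=
          (measure_mono hsub).trans (measure_union_le _ _)
      _ ≤ A * volume O + ENNReal.ofReal s⁻¹ * (B * ∫⁻ x in Oᶜ, coneIntegral H x) := by
          gcongr
          exact hcheb.trans (mul_le_mul_right (setLIntegral_vertIntegral_le hH hO) _)
      _ = _ := by rw [hOc]; ring
  have hlayF := lintegral_Ioi_rpow_mul_setLIntegral_lt (μ := volume) hq0 hF (w := fun _ => 1)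
    measurable_const
  have hlayG := lintegral_Ioi_rpow_mul_setLIntegral_lt (μ := volume) hq0 hG (w := fun _ => 1)
    measurable_const
  have hlow := lintegral_Ioi_rpow_mul_setLIntegral_le (μ := volume) hq1 hG
  simp only [setLIntegral_const, one_mul] at hlayF hlayG
  have hqq : ENNReal.ofReal q * ENNReal.ofReal (1 / q) = 1 := by
    rw [← ENNReal.ofReal_mul hq0.le, mul_one_div_cancel hq0.ne', ENNReal.ofReal_one]
  have hmeas : Measurable fun s : ℝ => ENNReal.ofReal (s ^ (q - 1)) *
      volume {x | ENNReal.ofReal s < coneIntegral H x} := by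
    refine Measurable.mul (by fun_prop) ?_
    exact measurable_measure_prodMk_left (ν := volume)
      (s := {z : ℝ × EuclideanSpace ℝ (Fin n) | ENNReal.ofReal z.1 < coneIntegral H z.2})
      (measurableSet_lt (by fun_prop) (by fun_prop))
  calc
    ∫⁻ x, vertIntegral H x ^ q
      = ENNReal.ofReal q * ∫⁻ s in Ioi (0 : ℝ), ENNReal.ofReal (s ^ (q - 1)) *
          volume {x | ENNReal.ofReal s < vertIntegral H x} := by
        rw [hlayF, ← mul_assoc, hqq, one_mul]
    _ ≤ ENNReal.ofReal q * ∫⁻ s in Ioi (0 : ℝ), (A * (ENNReal.ofReal (s ^ (q - 1)) *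
          volume {x | ENNReal.ofReal s < coneIntegral H x}) + B * (ENNReal.ofReal (s ^ (q - 2)) *
          ∫⁻ x in {x | coneIntegral H x ≤ ENNReal.ofReal s}, coneIntegral H x)) := by
        refine mul_le_mul_right (setLIntegral_mono' measurableSet_Ioi fun s hs => ?_) _
        have hs : 0 < s := hs
        calc
          _ ≤ ENNReal.ofReal (s ^ (q - 1)) *
              (A * volume {x | ENNReal.ofReal s < coneIntegral H x} +
                B * ENNReal.ofReal s⁻¹ * ∫⁻ x in {x | coneIntegral H x ≤ ENNReal.ofReal s},
                coneIntegral H x) := by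
            gcongr; exact hlevel s hs
          _ = _ := by
            rw [show q - 2 = q - 1 - 1 by ring, Real.rpow_sub_one hs.ne' (q - 1), div_eq_mul_inv,
              ENNReal.ofReal_mul (by positivity)]
            ring
    _ = ENNReal.ofReal q * (A * (ENNReal.ofReal (1 / q) * ∫⁻ x, coneIntegral H x ^ q) +
          B * ∫⁻ s in Ioi (0 : ℝ), (ENNReal.ofReal (s ^ (q - 2)) *
          ∫⁻ x in {x | coneIntegral H x ≤ ENNReal.ofReal s}, coneIntegral H x)) := by
        rw [lintegral_add_left (hmeas.const_mul _), lintegral_const_mul' _ _ (by finiteness),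
          lintegral_const_mul' _ _ hBt, hlayG]
    _ ≤ ENNReal.ofReal q * (A * (ENNReal.ofReal (1 / q) * ∫⁻ x, coneIntegral H x ^ q) +
          B * (ENNReal.ofReal (1 / (1 - q)) * ∫⁻ x, coneIntegral H x ^ q)) := by gcongr
    _ = _ := by ring

theorem exists_lintegral_coneIntegral_rpow_le (n : ℕ) {q : ℝ} (hq : 1 < q) :
    ∃ C : ℝ≥0∞, C ≠ ∞ ∧ ∀ H : ℝ × EuclideanSpace ℝ (Fin n) → ℝ≥0∞, Measurable H →
      ∫⁻ x, coneIntegral H x ^ q ≤ C * ∫⁻ x, vertIntegral H x ^ q := by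
  have hpq : q.HolderConjugate (Real.conjExponent q) := Real.HolderConjugate.conjExponent hq
  set r := Real.conjExponent q with hr
  have hq0 : 0 < q := hpq.pos
  have hr0 : 0 < r := hpq.symm.pos
  obtain ⟨D, hD, hmax⟩ := exists_lintegral_centredMaximal_rpow_le
    (volume : Measure (EuclideanSpace ℝ (Fin n))) hpq.symm.lt
  have hωt : volume (ball (0 : EuclideanSpace ℝ (Fin n)) 1) ≠ ∞ := measure_ball_lt_top.ne
  set A : ℝ≥0∞ := 2 ^ n * volume (ball (0 : EuclideanSpace ℝ (Fin n)) 1) * D ^ (1 / r) with hA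
  have hAt : A ≠ ∞ := by finiteness
  refine ⟨A ^ q, by finiteness, fun H hH => ?_⟩
  have hF := measurable_vertIntegral hH
  have hG := measurable_coneIntegral hH
  -- Truncating in height and in space makes `∫ m k ^ q` finite, so that a power of it can be
  -- cancelled below; monotone convergence removes the truncation.
  set m : ℕ → EuclideanSpace ℝ (Fin n) → ℝ≥0∞ := fun k =>
    (ball 0 (k : ℝ)).indicator fun x => min (coneIntegral H x) k with hm
  have hmm : ∀ k, Measurable (m k) := fun k =>
    (hG.min measurable_const).indicator measurableSet_ball
  have hmG : ∀ k x, m k x ≤ coneIntegral H x := fun k x =>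
    (indicator_le_self' (fun _ _ => zero_le) x).trans (min_le_left _ _)
  have hmono : Monotone m := by
    intro j k hjk x
    have hjk' : (j : ℝ) ≤ k := by exact_mod_cast hjk
    have hjk'' : (j : ℝ≥0∞) ≤ k := by exact_mod_cast hjk
    calc m j x ≤ (ball 0 (k : ℝ)).indicator (fun x => min (coneIntegral H x) j) x :=
          indicator_le_indicator_of_subset (ball_subset_ball hjk') (fun _ => zero_le) x
      _ ≤ _ := indicator_le_indicator (min_le_min_left _ hjk'')
  have hsup : ∀ x, ⨆ k, m k x ^ q = coneIntegral H x ^ q := by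
    intro x
    refine le_antisymm (iSup_le fun k => ENNReal.rpow_le_rpow (hmG k x) hq0.le) ?_
    refine le_of_forall_lt fun c hc => ?_
    have hc' : c ^ (1 / q) < coneIntegral H x := by
      have := ENNReal.rpow_lt_rpow hc (show 0 < 1 / q by positivity)
      rwa [← ENNReal.rpow_mul, mul_one_div_cancel hq0.ne', ENNReal.rpow_one] at this
    obtain ⟨k₁, hk₁⟩ := ENNReal.exists_nat_gt hc'.ne_top
    obtain ⟨k₂, hk₂⟩ := exists_nat_gt ‖x‖
    have hx : x ∈ ball (0 : EuclideanSpace ℝ (Fin n)) ((max k₁ k₂ : ℕ) : ℝ) := by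
      rw [mem_ball_zero_iff]
      exact hk₂.trans_le (by exact_mod_cast le_max_right _ _)
    refine lt_iSup_iff.2 ⟨max k₁ k₂, ?_⟩
    have hlt : c ^ (1 / q) < m (max k₁ k₂) x := by
      rw [hm]
      simp only [indicator_of_mem hx]
      exact lt_min hc' (hk₁.trans_le (by exact_mod_cast le_max_left _ _))
    have := ENNReal.rpow_lt_rpow hlt hq0
    rwa [← ENNReal.rpow_mul, one_div_mul_cancel hq0.ne', ENNReal.rpow_one] at this
  have hfin : ∀ k, ∫⁻ x, m k x ^ q ≠ ∞ := by
    intro k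
    refine ne_top_of_le_ne_top (b := (k : ℝ≥0∞) ^ q *
      volume (ball (0 : EuclideanSpace ℝ (Fin n)) k)) ?_ ?_
    · exact ENNReal.mul_ne_top (by finiteness) measure_ball_lt_top.ne
    · rw [← setLIntegral_const, ← lintegral_indicator measurableSet_ball]
      refine lintegral_mono fun x => ?_
      by_cases h : x ∈ ball (0 : EuclideanSpace ℝ (Fin n)) k
      · simp only [hm, indicator_of_mem h]
        exact ENNReal.rpow_le_rpow (min_le_right _ _) hq0.le
      · simp only [hm, indicator_of_notMem h, ENNReal.zero_rpow_of_pos hq0, le_refl]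
  have hbound : ∀ k, ∫⁻ x, m k x ^ q ≤ A ^ q * ∫⁻ x, vertIntegral H x ^ q := by
    intro k
    set T := ∫⁻ x, m k x ^ q with hT
    have hφ : Measurable fun x => m k x ^ (q - 1) := (hmm k).pow_const _
    have hM := measurable_centredMaximal volume hφ
    have hexp : (q - 1) * r = q := hpq.sub_one_mul_conj
    -- The test weight is `m k ^ (q - 1)`; as `(q - 1) * r = q`, its `L^r` norm is `T ^ (1 / r)`,
    -- and dividing by this leaves `T ^ (1 / q)`.
    have h1 : T ≤ A * (∫⁻ x, vertIntegral H x ^ q) ^ (1 / q) * T ^ (1 / r) := by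
      calc T ≤ ∫⁻ x, m k x ^ (q - 1) * coneIntegral H x := by
            refine lintegral_mono fun x => ?_
            have : m k x ^ q = m k x ^ (q - 1) * m k x := by
              nth_rw 3 [← ENNReal.rpow_one (m k x)]
              rw [← ENNReal.rpow_add_of_nonneg _ _ (by linarith) (by norm_num)]
              ring_nf
            rw [this]
            gcongr
            exact hmG k x
        _ ≤ _ := lintegral_mul_coneIntegral_le hH hφ
        _ ≤ 2 ^ n * volume (ball (0 : EuclideanSpace ℝ (Fin n)) 1) *
            ((∫⁻ x, vertIntegral H x ^ q) ^ (1 / q) *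
              (∫⁻ x, centredMaximal volume (fun x => m k x ^ (q - 1)) x ^ r) ^ (1 / r)) := by
            gcongr
            exact ENNReal.lintegral_mul_le_Lp_mul_Lq volume hpq hF.aemeasurable hM.aemeasurable
        _ ≤ 2 ^ n * volume (ball (0 : EuclideanSpace ℝ (Fin n)) 1) *
            ((∫⁻ x, vertIntegral H x ^ q) ^ (1 / q) * (D * T) ^ (1 / r)) := by
            gcongr
            refine (hmax _ hφ).trans (le_of_eq ?_)
            simp_rw [← ENNReal.rpow_mul, hexp, hT]
        _ = _ := by
            rw [ENNReal.mul_rpow_of_nonneg _ _ (by positivity), hA]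
            ring
    rcases eq_or_ne T 0 with h0 | h0
    · rw [h0]; exact zero_le
    have hTr0 : T ^ (1 / r) ≠ 0 := (ENNReal.rpow_pos (pos_iff_ne_zero.2 h0) (hfin k)).ne'
    have hTrt : T ^ (1 / r) ≠ ∞ := ENNReal.rpow_ne_top_of_nonneg (by positivity) (hfin k)
    have hsplit : T = T ^ (1 / q) * T ^ (1 / r) := by
      rw [← ENNReal.rpow_add _ _ h0 (hfin k), one_div, one_div, hpq.inv_add_inv_eq_one,
        ENNReal.rpow_one]
    have h2 : T ^ (1 / q) ≤ A * (∫⁻ x, vertIntegral H x ^ q) ^ (1 / q) := by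
      exact (ENNReal.mul_le_mul_iff_left hTr0 hTrt).1 (hsplit.symm.trans_le h1)
    have h3 := ENNReal.rpow_le_rpow h2 hq0.le
    rwa [ENNReal.mul_rpow_of_nonneg _ _ hq0.le, ← ENNReal.rpow_mul, ← ENNReal.rpow_mul,
      one_div_mul_cancel hq0.ne', ENNReal.rpow_one, ENNReal.rpow_one] at h3
  calc ∫⁻ x, coneIntegral H x ^ q = ∫⁻ x, ⨆ k, m k x ^ q := by simp_rw [hsup]
    _ = ⨆ k, ∫⁻ x, m k x ^ q := by
        refine lintegral_iSup (fun k => (hmm k).pow_const _) fun j k hjk x => ?_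
        exact ENNReal.rpow_le_rpow (hmono hjk x) hq0.le
    _ ≤ _ := iSup_le hbound

/-- Countably many compact sets exhaust the half space, and measurability on each is part of the
hypothesis. -/
theorem LocallySquareIntegrable.aestronglyMeasurable {g : ℝ × EuclideanSpace ℝ (Fin n) → ℂ}
    (hg : LocallySquareIntegrable g) :
    AEStronglyMeasurable g (volume.restrict (upperHalfSpace n)) := by
  have hU : upperHalfSpace n = ⋃ k : ℕ,
      Icc ((k + 1 : ℝ)⁻¹) (k + 1) ×ˢ closedBall (0 : EuclideanSpace ℝ (Fin n)) k := by
    ext z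
    simp only [upperHalfSpace, Set.mem_ofPred_eq, mem_iUnion, mem_prod, mem_Icc,
      mem_closedBall_zero_iff]
    constructor
    · intro hz
      obtain ⟨k, hk⟩ := exists_nat_ge (max (max z.1 z.1⁻¹) ‖z.2‖)
      obtain ⟨h12, h3⟩ := max_le_iff.1 hk
      obtain ⟨h1, h2⟩ := max_le_iff.1 h12
      exact ⟨k, ⟨inv_le_of_inv_le₀ hz (by linarith), by linarith⟩, h3⟩
    · rintro ⟨k, ⟨h1, -⟩, -⟩
      exact lt_of_lt_of_le (by positivity) h1
  rw [hU, aestronglyMeasurable_iUnion_iff]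
  intro k
  refine (hg _ (isCompact_Icc.prod (isCompact_closedBall _ _)) ?_).aestronglyMeasurable
  rw [hU]
  exact subset_iUnion (fun k : ℕ =>
    Icc ((k + 1 : ℝ)⁻¹) (k + 1) ×ˢ closedBall (0 : EuclideanSpace ℝ (Fin n)) k) k

/-- The square functions of a locally square integrable function are those of a Borel density. -/
theorem LocallySquareIntegrable.exists_measurable_density
    {g : ℝ × EuclideanSpace ℝ (Fin n) → ℂ} (hg : LocallySquareIntegrable g) :
    ∃ H : ℝ × EuclideanSpace ℝ (Fin n) → ℝ≥0∞, Measurable H ∧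
      (conicalSquare 1 g = fun x => coneIntegral H x ^ (1 / 2 : ℝ)) ∧
      verticalSquare g =ᵐ[volume] fun x => vertIntegral H x ^ (1 / 2 : ℝ) := by
  have hgm := hg.aestronglyMeasurable
  refine ⟨fun z => ‖hgm.mk g z‖ₑ ^ 2, hgm.stronglyMeasurable_mk.measurable.enorm.pow_const 2,
    ?_, ?_⟩
  · ext x
    rw [conicalSquare, coneIntegral]
    congr 1
    refine lintegral_congr_ae ?_
    filter_upwards [hgm.ae_eq_mk] with z hz
    rw [hz, one_mul]
  -- Changing `g` on a null set can alter `Vg` at individual points. Fubini, with the factors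
  -- swapped, gives agreement on almost every vertical line.
  · have hae : ∀ᵐ z ∂(volume.restrict (Ioi (0 : ℝ))).prod volume, g z = hgm.mk g z := by
      have h : ∀ᵐ z ∂volume.restrict (upperHalfSpace n), g z = hgm.mk g z := hgm.ae_eq_mk
      generalize hgm.mk g = g' at h ⊢
      rwa [volume_restrict_upperHalfSpace] at h
    have hswap : ∀ᵐ w ∂(volume : Measure (EuclideanSpace ℝ (Fin n))).prod
        (volume.restrict (Ioi (0 : ℝ))), g w.swap = hgm.mk g w.swap :=
      Measure.measurePreserving_swap.quasiMeasurePreserving.ae hae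
    filter_upwards [Measure.ae_ae_of_ae_prod hswap] with x hx
    rw [verticalSquare, vertIntegral]
    congr 1
    refine lintegral_congr_ae ?_
    filter_upwards [hx] with t ht
    simp only [Prod.swap_prod_mk] at ht
    rw [ht]

theorem eLpNorm_sqrt_eq {X : Type*} [MeasurableSpace X] {μ : Measure X} {p : ℝ} (hp : 0 < p)
    (F : X → ℝ≥0∞) :
    eLpNorm (fun x => F x ^ (1 / 2 : ℝ)) (ENNReal.ofReal p) μ =
      (∫⁻ x, F x ^ (p / 2) ∂μ) ^ (1 / p) := by
  rw [eLpNorm_eq_lintegral_rpow_enorm_toReal (by simpa using hp) ENNReal.ofReal_ne_top,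
    ENNReal.toReal_ofReal hp.le]
  congr 1
  refine lintegral_congr fun x => ?_
  rw [enorm_eq_self, ← ENNReal.rpow_mul]
  ring_nf

end Comparison

/-! ### Passage from densities back to `g`, for `p` below, at and above `2`. -/

theorem corollary2 (n : ℕ) (p : ℝ) (hp : 0 < p) :
    ∃ C : ℝ, 0 < C ∧
      ∀ g : ℝ × EuclideanSpace ℝ (Fin n) → ℂ, LocallySquareIntegrable g →
        (p ≤ 2 →
          eLpNorm (verticalSquare g) (ENNReal.ofReal p) volume
            ≤ ENNReal.ofReal C * tentNorm p 1 g) ∧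
        (2 ≤ p →
          ENNReal.ofReal C * tentNorm p 1 g
            ≤ eLpNorm (verticalSquare g) (ENNReal.ofReal p) volume) := by
  have hp1 : 0 ≤ 1 / p := by positivity
  have hred : ∀ g : ℝ × EuclideanSpace ℝ (Fin n) → ℂ, LocallySquareIntegrable g →
      ∃ H : ℝ × EuclideanSpace ℝ (Fin n) → ℝ≥0∞, Measurable H ∧
        tentNorm p 1 g = (∫⁻ x, coneIntegral H x ^ (p / 2)) ^ (1 / p) ∧
        eLpNorm (verticalSquare g) (ENNReal.ofReal p) volume =
          (∫⁻ x, vertIntegral H x ^ (p / 2)) ^ (1 / p) := by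
    intro g hg
    obtain ⟨H, hH, hc, hv⟩ := hg.exists_measurable_density
    refine ⟨H, hH, ?_, ?_⟩
    · rw [tentNorm, hc, eLpNorm_sqrt_eq hp]
    · rw [eLpNorm_congr_ae hv, eLpNorm_sqrt_eq hp]
  rcases lt_trichotomy p 2 with h | rfl | h
  · obtain ⟨C, hC, hbound⟩ := exists_lintegral_vertIntegral_rpow_le n (q := p / 2)
      (by positivity) (by linarith)
    -- `C` may be zero; `C + 1` guarantees a positive constant.
    have hCt : (C + 1) ^ (1 / p) ≠ ∞ := by finiteness
    refine ⟨((C + 1) ^ (1 / p)).toReal, ENNReal.toReal_pos ?_ hCt, fun g hg => ⟨fun _ => ?_,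
      fun h2 => absurd h2 (not_le.2 h)⟩⟩
    · exact (ENNReal.rpow_pos (by positivity) (by finiteness)).ne'
    · obtain ⟨H, hH, hc, hv⟩ := hred g hg
      rw [hc, hv, ENNReal.ofReal_toReal hCt, ← ENNReal.mul_rpow_of_nonneg _ _ hp1]
      refine ENNReal.rpow_le_rpow ((hbound H hH).trans ?_) hp1
      gcongr
      exact le_self_add
  · have hω0 : volume (ball (0 : EuclideanSpace ℝ (Fin n)) 1) ≠ 0 :=
      (measure_ball_pos _ _ one_pos).ne'
    have hωt : volume (ball (0 : EuclideanSpace ℝ (Fin n)) 1) ≠ ∞ := measure_ball_lt_top.ne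
    set ω := volume (ball (0 : EuclideanSpace ℝ (Fin n)) 1) with hω
    have hCt : ω⁻¹ ^ (1 / 2 : ℝ) ≠ ∞ := by finiteness
    have hC0 : ω⁻¹ ^ (1 / 2 : ℝ) ≠ 0 :=
      (ENNReal.rpow_pos (by simpa using hωt) (by finiteness)).ne'
    refine ⟨(ω⁻¹ ^ (1 / 2 : ℝ)).toReal, ENNReal.toReal_pos hC0 hCt, fun g hg => ?_⟩
    obtain ⟨H, hH, hc, hv⟩ := hred g hg
    have heq : eLpNorm (verticalSquare g) (ENNReal.ofReal 2) volume =
        ENNReal.ofReal (ω⁻¹ ^ (1 / 2 : ℝ)).toReal * tentNorm 2 1 g := by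
      rw [hc, hv, ENNReal.ofReal_toReal hCt, ← ENNReal.mul_rpow_of_nonneg _ _ hp1]
      simp only [div_self (two_ne_zero' ℝ), ENNReal.rpow_one]
      rw [lintegral_coneIntegral hH, ← mul_assoc, ENNReal.inv_mul_cancel hω0 hωt, one_mul]
    exact ⟨fun _ => heq.le, fun _ => heq.ge⟩
  · obtain ⟨C, hC, hbound⟩ := exists_lintegral_coneIntegral_rpow_le n (q := p / 2) (by linarith)
    -- The constant now multiplies the tent norm, so the bound is inverted; `C + 1` keeps the
    -- inverse finite.
    have hC1 : C + 1 ≠ 0 := by positivity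
    have hC1t : C + 1 ≠ ∞ := by finiteness
    have hCt : (C + 1)⁻¹ ^ (1 / p) ≠ ∞ := by finiteness
    refine ⟨((C + 1)⁻¹ ^ (1 / p)).toReal, ENNReal.toReal_pos ?_ hCt, fun g hg =>
      ⟨fun h2 => absurd h2 (not_le.2 h), fun _ => ?_⟩⟩
    · exact (ENNReal.rpow_pos (by simpa using hC) (by finiteness)).ne'
    · obtain ⟨H, hH, hc, hv⟩ := hred g hg
      rw [hc, hv, ENNReal.ofReal_toReal hCt, ← ENNReal.mul_rpow_of_nonneg _ _ hp1]
      refine ENNReal.rpow_le_rpow ?_ hp1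
      calc _ ≤ (C + 1)⁻¹ * ((C + 1) * ∫⁻ x, vertIntegral H x ^ (p / 2)) := by
            gcongr
            refine (hbound H hH).trans ?_
            gcongr
            exact le_self_add
        _ = _ := by rw [← mul_assoc, ENNReal.inv_mul_cancel hC1 hC1t, one_mul]
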